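/- Let $G=(V,E)$ be a finite graph with vertices $v_s$ (start) and $v_g$ (goal), and let $\tau\ge 1$ be a horizon. A world $\phi\in[0,1]^{E}$ is a vector of (normalized) edge weights, and the true world $\phi^*$ is drawn from an arbitrary prior probability distribution $P$ on $[0,1]^E$. Every world $\phi$ defines a deterministic MDP $M_\phi$ with horizon $\tau$: the states are the vertices, $S=V$; the actions $A(s)$ at $s$ are the edges adjacent to $s$; an action moves to the other endpoint of its edge; the reward of the action $e$ at $s$ is $0$ if $s=v_g$ and $-\phi(e)$ otherwise; the initial state is $v_s$. Write $|S|=|V|$ and $|A|=\max_s|A(s)|$. The admissible policies are the partial policies $\pi$ that correspond to paths from $v_s$ to $v_g$ with at most $\tau$ edges (at least one is assumed to exist); the value $V^{M_\phi}_\pi(v_s)$, the sum of the rewards over the $\tau$ steps of an episode, is minus the length of the path in $\phi$. Let $\pi^*(\phi)$ denote an admissible policy of maximal value in $M_\phi$, that is, a shortest path in $\phi$ (ties broken in any fixed measurable way). PSMP proceeds in episodes $k=1,2,\dots$. In episode $k$ it samples a world $\phi_k$ from the posterior distribution $P(\phi\mid\psi_{k-1})$, where the history $\psi_{k-1}$ consists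 of the true weights of all edges evaluated in earlier episodes; it then executes the shortest path $\pi_k=\pi^*(\phi_k)$ of the sampled graph in the true world, thereby evaluating (observing the true weights of) the edges on it. With $M^*=M_{\phi^*}$, the regret of $m$ episodes, measured against the best path discovered so far, is $$\mathrm{Regret}=\sum_{k=1}^{m}\Bigl(V^{M^*}_{\pi^*(\phi^*)}(v_s)-\max_{1\le j\le k}V^{M^*}_{\pi_j}(v_s)\Bigr).$$ Then there is a universal constant $C>0$ such that for all $G$, $v_s$, $v_g$, $\tau$, $P$ as above and every total number $T$ of time steps, i.e. for $m=\lceil T/\tau\rceil$ episodes of $\tau$ steps (so $T=m\tau$ for whole episodes), the expected regret over the prior and the random sampling of PSMP (the Bayesian regret) is finite and satisfies $$\mathbb E[\mathrm{Regret}]\le C\,\tau\sqrt{|S||A|\,T\,\log(|S||A|\,T)} .$$ -/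

import Mathlib

open MeasureTheory ProbabilityTheory
open scoped unitInterval

/-! ### Deterministic finite-horizon MDPs -/

/-- The known part `⟨S, A, T, τ, s₁⟩` of a deterministic finite-horizon MDP: state space `S`,
actions `A s` available at the state `s`, transition function, horizon, initial state. -/
structure DetDynamics (S : Type*) (A : S → Type*) where
  next : (s : S) → A s → S
  horizon : ℕ
  init : S

/-- A deterministic finite-horizon MDP: the dynamics together with a reward function. -/
structure DetMDP (S : Type*) (A : S → Type*) extends DetDynamics S A where
  reward : (s : S) → A s → ℝ

/-- The number of actions `|A|`: the largest number of actions available at a state. -/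
noncomputable def numActions {S : Type*} (A : S → Type*) : ℕ := ⨆ s, Nat.card (A s)

/-- A (deterministic, stationary) partial policy. Where it is undefined, the agent stops. -/
abbrev PartialPolicy (S : Type*) (A : S → Type*) : Type _ := (s : S) → Option (A s)

namespace DetDynamics

variable {S : Type*} {A : S → Type*}

/-- The state that follows `s` under the policy `π`. -/
def step (D : DetDynamics S A) (π : PartialPolicy S A) (s : S) : S :=
  match π s with
  | none => s
  | some a => D.next s a

/-- The state reached from the initial state after `j` steps of the policy `π`. -/
def state (D : DetDynamics S A) (π : PartialPolicy S A) (j : ℕ) : S := (D.step π)^[j] D.init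

end DetDynamics

namespace DetMDP

variable {S : Type*} {A : S → Type*}

/-- The reward collected at the state `s` by the policy `π` (none once it has stopped). -/
def stepReward (M : DetMDP S A) (π : PartialPolicy S A) (s : S) : ℝ :=
  match π s with
  | none => 0
  | some a => M.reward s a

/-- The value of the policy `π` from the initial state: the sum of the rewards over one episode. -/
noncomputable def value (M : DetMDP S A) (π : PartialPolicy S A) : ℝ :=
  ∑ j ∈ Finset.range M.horizon, M.stepReward π (M.state π j)

end DetMDP

/-! ### Planning on a graph as an MDP -/

/-- A world: the vector of the edge weights, normalized to `[0, 1]`. -/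
abbrev World {V : Type*} (G : SimpleGraph V) : Type _ := G.edgeSet → I

/-- The actions at a vertex are the edges adjacent to it. -/
abbrev GraphAction {V : Type*} (G : SimpleGraph V) (s : V) : Type _ := G.incidenceSet s

/-- The edge, as an edge of `G`, that is traversed by an action. -/
def GraphAction.edge {V : Type*} {G : SimpleGraph V} {s : V} (a : GraphAction G s) : G.edgeSet :=
  ⟨a.1, a.2.1⟩

/-- A policy on a graph. -/
abbrev GraphPolicy {V : Type*} (G : SimpleGraph V) : Type _ := PartialPolicy V (GraphAction G)

section Planning

variable {V : Type*} [DecidableEq V]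

/-- The known dynamics of a planning problem: an action moves along an adjacent edge. -/
def graphDynamics (G : SimpleGraph V) (start : V) (τ : ℕ) : DetDynamics V (GraphAction G) where
  next := fun _ a => G.otherVertexOfIncident a.2
  horizon := τ
  init := start

/-- The MDP of the world `φ`: the reward is `0` at the goal, and elsewhere minus the weight of the
traversed edge. -/
noncomputable def graphMDP (G : SimpleGraph V) (start goal : V) (τ : ℕ) (φ : World G) :
    DetMDP V (GraphAction G) where
  toDetDynamics := graphDynamics G start τ
  reward := fun s a => if s = goal then 0 else -(φ a.edge : ℝ)

/-- The policies that correspond to paths from `start` to `goal` with at most `τ` edges: those that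
have arrived at the goal within the horizon, and stop there. -/
def IsPathPolicy (G : SimpleGraph V) (start goal : V) (τ : ℕ) (π : GraphPolicy G) : Prop :=
  π goal = none ∧ (graphDynamics G start τ).state π τ = goal

/-- The edges traversed by the policy `π` in an episode, that is, the edges of its path. -/
def traversedEdges (G : SimpleGraph V) (start : V) (τ : ℕ) (π : GraphPolicy G) : Set G.edgeSet :=
  {e | ∃ j < τ, ∃ a : GraphAction G ((graphDynamics G start τ).state π j),
    π ((graphDynamics G start τ).state π j) = some a ∧ a.edge = e}

/-- A shortest path solver: it returns, for each world, a path of maximal value (that is, of minimal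
length) in it. Ties are broken in any fixed measurable way. -/
structure ShortestPathSolver (G : SimpleGraph V) (start goal : V) (τ : ℕ) where
  policy : World G → GraphPolicy G
  isPath : ∀ φ, IsPathPolicy G start goal τ (policy φ)
  optimal : ∀ φ π, IsPathPolicy G start goal τ π →
    (graphMDP G start goal τ φ).value π ≤ (graphMDP G start goal τ φ).value (policy φ)
  measurable : ∀ π, MeasurableSet {φ | policy φ = π}

/-! ### Posterior sampling -/

/-- The posterior `P(φ | ψ)` on worlds given the weights of the edges in `O`: the regular
conditional distribution of a world `φ` with law `P` given the restriction of `φ` to `O`. -/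
noncomputable def worldPosterior [Finite V] {G : SimpleGraph V} (P : Measure (World G))
    [IsFiniteMeasure P] (O : Set G.edgeSet) : Kernel (O → I) (World G) :=
  condDistrib (fun φ : World G => φ) (fun φ : World G => O.domRestrict φ) P

instance [Finite V] {G : SimpleGraph V} (P : Measure (World G)) [IsFiniteMeasure P]
    (O : Set G.edgeSet) : IsMarkovKernel (worldPosterior P O) := by
  unfold worldPosterior; infer_instance

/-- The edges evaluated by PSMP in the episodes `1, …, n`, if the worlds `x 1, …, x n` were
sampled in them. (The entry `x 0` is the true world, and is not used here.) -/
def evaluatedEdges {G : SimpleGraph V} {start goal : V} {τ : ℕ}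
    (solver : ShortestPathSolver G start goal τ) (n : ℕ)
    (x : (i : Finset.Iic n) → World G) : Set G.edgeSet :=
  {e | ∃ i : Finset.Iic n, 1 ≤ (i : ℕ) ∧ e ∈ traversedEdges G start τ (solver.policy (x i))}

/-- The episode `n + 1` of PSMP: given the true world `x 0` and the worlds `x 1, …, x n` sampled
so far, the next world is sampled from the posterior given the true weights of all the
edges evaluated so far. -/
noncomputable def psmpKernel [Finite V] {G : SimpleGraph V} {start goal : V} {τ : ℕ}
    (P : Measure (World G)) [IsFiniteMeasure P] (solver : ShortestPathSolver G start goal τ)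
    (n : ℕ) : Kernel ((i : Finset.Iic n) → World G) (World G) where
  toFun x := worldPosterior P (evaluatedEdges solver n x)
    ((evaluatedEdges solver n x).domRestrict (x ⟨0, by simp⟩))
  measurable' := by
    have hO : Measurable (evaluatedEdges solver n) := by
      refine measurable_set_iff.2 fun e => measurableSet_setOfPred.1 ?_
      have : {x | e ∈ evaluatedEdges solver n x} =
          ⋃ i : Finset.Iic n, ⋃ π : GraphPolicy G,
            {x | 1 ≤ (i : ℕ) ∧ e ∈ traversedEdges G start τ π} ∩
              (fun x : (i : Finset.Iic n) → World G => x i) ⁻¹' {φ | solver.policy φ = π} := by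
        ext x
        simp [evaluatedEdges]
      rw [this]
      exact MeasurableSet.iUnion fun i => MeasurableSet.iUnion fun π =>
        (MeasurableSet.const _).inter (measurable_pi_apply i (solver.measurable π))
    have hg : Measurable (fun p : ((i : Finset.Iic n) → World G) × Set G.edgeSet =>
        worldPosterior P p.2 (p.2.domRestrict (p.1 ⟨0, by simp⟩))) := by
      refine measurable_from_prod_countable_left fun O => ?_
      refine (worldPosterior P O).measurable.comp ?_
      exact measurable_pi_lambda _ fun e => by
        simp only [Set.domRestrict_apply]; fun_prop
    exact hg.comp (measurable_id.prodMk hO)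

instance [Finite V] {G : SimpleGraph V} {start goal : V} {τ : ℕ}
    (P : Measure (World G)) [IsFiniteMeasure P] (solver : ShortestPathSolver G start goal τ)
    (n : ℕ) : IsMarkovKernel (psmpKernel P solver n) :=
  ⟨fun x => inferInstanceAs (IsProbabilityMeasure (worldPosterior P (evaluatedEdges solver n x) _))⟩

/-- The joint law of the true world and of the worlds sampled by PSMP. In a sequence `x` of worlds,
`x 0` is the true world, drawn from the prior `P`, and `x k` for `k ≥ 1` is the world that PSMP
samples in the episode `k`. -/
noncomputable def psmpLaw [Finite V] {G : SimpleGraph V} {start goal : V} {τ : ℕ}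
    (P : Measure (World G)) [IsFiniteMeasure P] (solver : ShortestPathSolver G start goal τ) :
    Measure (ℕ → World G) :=
  Kernel.trajMeasure (X := fun _ => World G) P (psmpKernel P solver)

/-- The value in the true world `x 0` of the best of the policies executed in the
episodes `1, …, k + 1`. -/
noncomputable def bestDiscoveredValue {G : SimpleGraph V} {start goal : V} {τ : ℕ}
    (solver : ShortestPathSolver G start goal τ) (x : ℕ → World G) (k : ℕ) : ℝ :=
  (Finset.range (k + 1)).sup' Finset.nonempty_range_add_one fun j =>
    (graphMDP G start goal τ (x 0)).value (solver.policy (x (j + 1)))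

/-- The regret of `m` episodes: the sum over the episodes of the difference between the value, in
the true world, of the optimal policy and that of the best policy discovered so far. -/
noncomputable def regret {G : SimpleGraph V} {start goal : V} {τ : ℕ}
    (solver : ShortestPathSolver G start goal τ) (m : ℕ) (x : ℕ → World G) : ℝ :=
  ∑ k ∈ Finset.range m,
    ((graphMDP G start goal τ (x 0)).value (solver.policy (x 0)) - bestDiscoveredValue solver x k)

end Planning

/-! ### Posterior sampling: joint law of the true and sampled worlds. -/

section PosteriorSampling

open Preorder

variable {V : Type*} {G : SimpleGraph V}

/-! Write `W i` for the value in world `x i` of the policy that the solver returns for that world.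
Since the best discovered value is at least that of the latest policy, each regret term is at most
`W 0 - W (k + 1)` plus the overestimate `W (k + 1)` minus the value of the executed policy in `x 0`.

The first difference has mean zero, because each sampled world is distributed as the prior
(`psmpLaw_map_succ`). The subtle point is that the set of evaluated edges is itself random and
informative. But the probability of having evaluated exactly `S` depends on the true world only
through its weights on `S` (`exists_likelihood`), so it factors out of Bayes' rule, and the
posterior given those weights is the correct conditional law.

The overestimates are controlled pathwise. Observations are noiseless, so almost surely the sampled
world agrees with the true one on all edges evaluated before (`ae_psmpLaw_eqOn`). An episode on old
edges has no overestimate; any other costs at most `τ` and evaluates a new edge, so there are at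
most `min |E| m` such episodes. Hence the expected regret is at most `τ * min |E| m`, and a minimum
is at most the geometric mean, with `|E| ≤ |S||A|` and `m ≤ T`. -/

theorem measurable_edgeRestrict (S : Set G.edgeSet) :
    Measurable (fun φ : World G => S.domRestrict φ) :=
  measurable_pi_lambda _ fun _ => measurable_pi_apply _

/-- Integrating against the posterior and then against the prior is integrating against the
prior. -/
theorem lintegral_lintegral_worldPosterior [Finite V] (P : Measure (World G)) [IsFiniteMeasure P]
    (S : Set G.edgeSet) {f : (S → I) × World G → ENNReal} (hf : Measurable f) :
    ∫⁻ φ, ∫⁻ ψ, f (S.domRestrict φ, ψ) ∂worldPosterior P S (S.domRestrict φ) ∂P =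
      ∫⁻ φ, f (S.domRestrict φ, φ) ∂P := by
  have hr := measurable_edgeRestrict S
  have h := compProd_map_condDistrib (mβ := inferInstance)
    (X := fun φ : World G => S.domRestrict φ) (Y := fun φ : World G => φ) (μ := P)
    measurable_id.aemeasurable
  have h2 := congrArg (fun ν => ∫⁻ p, f p ∂ν) h
  rw [Measure.lintegral_compProd hf, lintegral_map hf.lintegral_kernel_prod_right' hr,
    lintegral_map hf (by fun_prop)] at h2
  exact h2

variable [DecidableEq V] {start goal : V} {τ : ℕ}

theorem evaluatedEdges_zero (solver : ShortestPathSolver G start goal τ)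
    (x : (i : Finset.Iic 0) → World G) : evaluatedEdges solver 0 x = ∅ := by
  ext e
  simp only [evaluatedEdges, Set.mem_ofPred_eq, Set.mem_empty_iff_false, iff_false]
  rintro ⟨i, h1, -⟩
  have := Finset.mem_Iic.1 i.2
  omega

theorem evaluatedEdges_succ (solver : ShortestPathSolver G start goal τ) (n : ℕ)
    (x : ℕ → World G) :
    evaluatedEdges solver (n + 1) (frestrictLe (n + 1) x) =
      evaluatedEdges solver n (frestrictLe n x) ∪
        traversedEdges G start τ (solver.policy (x (n + 1))) := by
  ext e
  simp only [evaluatedEdges, Set.mem_ofPred_eq, Set.mem_union, Subtype.exists, Finset.mem_Iic,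
    frestrictLe_apply]
  constructor
  · rintro ⟨i, hi, h1, he⟩
    rcases Nat.le_succ_iff.1 hi with h | rfl
    · exact Or.inl ⟨i, h, h1, he⟩
    · exact Or.inr he
  · rintro (⟨i, hi, h1, he⟩ | he)
    · exact ⟨i, by omega, h1, he⟩
    · exact ⟨n + 1, le_rfl, by omega, he⟩

variable [Finite V]

theorem measurableSet_policy_mem (solver : ShortestPathSolver G start goal τ)
    (Q : Set (GraphPolicy G)) : MeasurableSet {φ | solver.policy φ ∈ Q} := by
  have : {φ | solver.policy φ ∈ Q} = ⋃ π ∈ Q, {φ | solver.policy φ = π} := by ext; simp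
  rw [this]
  exact MeasurableSet.biUnion Q.to_countable fun π _ => solver.measurable π

theorem measurableSet_evaluatedEdges_eq (solver : ShortestPathSolver G start goal τ) (n : ℕ)
    (S : Set G.edgeSet) :
    MeasurableSet {x | evaluatedEdges solver n x = S} := by
  have hO : Measurable (evaluatedEdges solver n) := by
    refine measurable_set_iff.2 fun e => measurableSet_setOfPred.1 ?_
    have : {x | e ∈ evaluatedEdges solver n x} =
        ⋃ i : Finset.Iic n,
          (fun x : (i : Finset.Iic n) → World G => x i) ⁻¹'
            {φ | solver.policy φ ∈ {π | 1 ≤ (i : ℕ) ∧ e ∈ traversedEdges G start τ π}} := by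
      ext x
      simp [evaluatedEdges]
    rw [this]
    exact MeasurableSet.iUnion fun i => measurable_pi_apply i (measurableSet_policy_mem solver _)
  exact hO (MeasurableSet.singleton S)

variable (P : Measure (World G)) [IsProbabilityMeasure P]
  (solver : ShortestPathSolver G start goal τ)

instance : IsProbabilityMeasure (psmpLaw P solver) := by
  unfold psmpLaw; infer_instance

theorem psmpLaw_map_zero : (psmpLaw P solver).map (fun x => x 0) = P := by
  have h0 : (fun x : ℕ → World G => x 0) =
      (MeasurableEquiv.piUnique (fun _ : Finset.Iic 0 => World G)) ∘ frestrictLe 0 := rfl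
  rw [h0, ← Measure.map_map (MeasurableEquiv.measurable _) (by fun_prop), psmpLaw,
    Kernel.trajMeasure, Measure.map_comp _ _ (by fun_prop), Kernel.traj_map_frestrictLe,
    Kernel.partialTraj_self, Measure.id_comp, Measure.map_map (by fun_prop) (by fun_prop)]
  convert! Measure.map_id

/-- The event that the edges evaluated in the episodes `1, …, n` are those in `S`. -/
def evaluatedEvent (n : ℕ) (S : Set G.edgeSet) : Set (ℕ → World G) :=
  {x | evaluatedEdges solver n (frestrictLe n x) = S}

theorem measurableSet_evaluatedEvent (n : ℕ) (S : Set G.edgeSet) :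
    MeasurableSet (evaluatedEvent solver n S) :=
  measurable_frestrictLe (X := fun _ => World G) n (measurableSet_evaluatedEdges_eq solver n S)

/-- There are finitely many edge sets, so one can condition on the evaluated set. On each piece the
set is a constant `S`, and the posterior becomes a single kernel on `S → I`. -/
theorem lintegral_eq_sum_evaluatedEvent [Fintype (Set G.edgeSet)] (n : ℕ)
    (f : (ℕ → World G) → ENNReal) :
    ∫⁻ x, f x ∂psmpLaw P solver =
      ∑ S, ∫⁻ x in evaluatedEvent solver n S, f x ∂psmpLaw P solver := by
  have hU : (⋃ S ∈ (Finset.univ : Finset (Set G.edgeSet)), evaluatedEvent solver n S) =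
      Set.univ := by
    ext x; simp [evaluatedEvent]
  rw [← setLIntegral_univ, ← hU, lintegral_biUnion_finset]
  · intro S _ S' _ h
    exact Set.disjoint_left.2 fun x hx hx' => h (hx.symm.trans hx')
  · exact fun S _ => measurableSet_evaluatedEvent solver n S

/-- On the event that the edges in `S` were evaluated, the next world is sampled from the posterior
given their weights. -/
theorem setLIntegral_evaluatedEvent_succ (n : ℕ) (S : Set G.edgeSet)
    {F : World G × World G → ENNReal} (hF : Measurable F) :
    ∫⁻ x in evaluatedEvent solver n S, F (x 0, x (n + 1)) ∂psmpLaw P solver =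
      ∫⁻ x in evaluatedEvent solver n S,
        ∫⁻ ψ, F (x 0, ψ) ∂worldPosterior P S (S.domRestrict (x 0)) ∂psmpLaw P solver := by
  -- Disintegration of the trajectory law at time `n + 1`, tested below against functions supported
  -- on histories with evaluated set `S`.
  have h := Kernel.map_frestrictLe_trajMeasure_compProd_eq_map_trajMeasure (X := fun _ => World G)
    (μ₀ := P) (κ := psmpKernel P solver) (a := n)
  let A : Set (((i : Finset.Iic n) → World G)) := {y | evaluatedEdges solver n y = S}
  have hA : MeasurableSet A := measurableSet_evaluatedEdges_eq solver n S
  let f : (((i : Finset.Iic n) → World G)) × World G → ENNReal :=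
    (Prod.fst ⁻¹' A).indicator fun p => F (p.1 ⟨0, by simp⟩, p.2)
  have hf : Measurable f := by
    refine Measurable.indicator ?_ (measurable_fst hA)
    fun_prop
  have h2 := congrArg (fun ν => ∫⁻ p, f p ∂ν) h
  rw [Measure.lintegral_compProd hf, lintegral_map hf.lintegral_kernel_prod_right' (by fun_prop),
    lintegral_map hf (by fun_prop)] at h2
  rw [← lintegral_indicator (measurableSet_evaluatedEvent solver n S),
    ← lintegral_indicator (measurableSet_evaluatedEvent solver n S)]
  refine Eq.trans ?_ (h2.symm.trans ?_)
  · refine lintegral_congr fun x => ?_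
    by_cases hx : x ∈ evaluatedEvent solver n S
    · have : (frestrictLe n x, x (n + 1)) ∈
          (Prod.fst ⁻¹' A : Set (((i : Finset.Iic n) → World G) × World G)) := hx
      simp only [Set.indicator_of_mem hx, f]
      rw [Set.indicator_of_mem this]
      rfl
    · have : (frestrictLe n x, x (n + 1)) ∉
          (Prod.fst ⁻¹' A : Set (((i : Finset.Iic n) → World G) × World G)) := hx
      simp only [Set.indicator_of_notMem hx, f]
      rw [Set.indicator_of_notMem this]
  · refine lintegral_congr fun x => ?_
    by_cases hx : x ∈ evaluatedEvent solver n S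
    · have : ∀ ψ, (frestrictLe n x, ψ) ∈
          (Prod.fst ⁻¹' A : Set (((i : Finset.Iic n) → World G) × World G)) := fun _ => hx
      simp only [Set.indicator_of_mem hx, f, Set.indicator_of_mem (this _)]
      have hk : psmpKernel P solver n (frestrictLe n x) =
          worldPosterior P S (S.domRestrict (x 0)) := by
        change worldPosterior P (evaluatedEdges solver n (frestrictLe n x))
          ((evaluatedEdges solver n (frestrictLe n x)).domRestrict (x 0)) = _
        have hx' : evaluatedEdges solver n (frestrictLe n x) = S := hx
        rw [hx']
      rw [hk]
      rfl
    · have : ∀ ψ, (frestrictLe n x, ψ) ∉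
          (Prod.fst ⁻¹' A : Set (((i : Finset.Iic n) → World G) × World G)) := fun _ => hx
      simp only [Set.indicator_of_notMem hx, f, Set.indicator_of_notMem (this _), lintegral_zero]

/-- The likelihood that the edges in `S` are evaluated in the episodes `1, …, n` depends on the true
world only through the weights of the edges in `S`. -/
theorem exists_likelihood (n : ℕ) (S : Set G.edgeSet) :
    ∃ l : (S → I) → ENNReal, Measurable l ∧ ∀ h : World G → ENNReal, Measurable h →
      ∫⁻ x in evaluatedEvent solver n S, h (x 0) ∂psmpLaw P solver =
        ∫⁻ φ, l (S.domRestrict φ) * h φ ∂P := by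
  classical
  have := Fintype.ofFinite (Set G.edgeSet)
  induction n generalizing S with
  | zero =>
    by_cases hS : S = ∅
    · refine ⟨1, measurable_one, fun h hh => ?_⟩
      have : evaluatedEvent solver 0 S = Set.univ := by
        ext x; simp [evaluatedEvent, evaluatedEdges_zero, hS]
      rw [this, setLIntegral_univ]
      conv_rhs => rw [← psmpLaw_map_zero P solver]
      simp only [Pi.one_apply, one_mul]
      rw [lintegral_map hh (measurable_pi_apply 0)]
    · refine ⟨0, measurable_zero, fun h hh => ?_⟩
      have : evaluatedEvent solver 0 S = ∅ := by
        ext x; simp [evaluatedEvent, evaluatedEdges_zero, Ne.symm hS]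
      simp [this]
  | succ n ih =>
    choose l hlm hl using ih
    let B : Set G.edgeSet → Set (World G) := fun S₀ =>
      {ψ | solver.policy ψ ∈ {π | S₀ ∪ traversedEdges G start τ π = S}}
    have hB : ∀ S₀, MeasurableSet (B S₀) := fun S₀ => measurableSet_policy_mem solver _
    -- Contribution of reaching `S` from `S₀`: the likelihood of `S₀` times the posterior
    -- probability that the next path completes `S₀` to `S`. As `S₀ ⊆ S`, both factors are functions
    -- of the weights on `S`.
    let q : Set G.edgeSet → (S → I) → ENNReal := fun S₀ y =>
      if hS : S₀ ⊆ S then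
        l S₀ (fun e => y (Set.inclusion hS e)) *
          worldPosterior P S₀ (fun e => y (Set.inclusion hS e)) (B S₀)
      else 0
    refine ⟨fun y => ∑ S₀, q S₀ y, ?_, fun h hh => ?_⟩
    · refine Finset.measurable_sum _ fun S₀ _ => ?_
      by_cases hS : S₀ ⊆ S
      · have hm : Measurable (fun (y : S → I) (e : S₀) => y (Set.inclusion hS e)) :=
          measurable_pi_lambda _ fun _ => measurable_pi_apply _
        simp only [q, dif_pos hS]
        exact ((hlm S₀).comp hm).mul
          (((worldPosterior P S₀).measurable_coe (hB S₀)).comp hm)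
      · simp only [q, dif_neg hS]
        exact measurable_const
    · rw [← lintegral_indicator (measurableSet_evaluatedEvent solver _ S),
        lintegral_eq_sum_evaluatedEvent P solver n]
      have hq : ∀ S₀, Measurable (fun φ : World G => l S₀ (S₀.domRestrict φ) *
          worldPosterior P S₀ (S₀.domRestrict φ) (B S₀)) := fun S₀ =>
        ((hlm S₀).comp (measurable_edgeRestrict S₀)).mul
          (((worldPosterior P S₀).measurable_coe (hB S₀)).comp (measurable_edgeRestrict S₀))
      have key : ∀ S₀, ∫⁻ x in evaluatedEvent solver n S₀,
          (evaluatedEvent solver (n + 1) S).indicator (fun x => h (x 0)) x ∂psmpLaw P solver =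
            ∫⁻ φ, q S₀ (S.domRestrict φ) * h φ ∂P := by
        intro S₀
        have e1 : ∫⁻ x in evaluatedEvent solver n S₀,
            (evaluatedEvent solver (n + 1) S).indicator (fun x => h (x 0)) x ∂psmpLaw P solver =
            ∫⁻ x in evaluatedEvent solver n S₀,
              (fun p : World G × World G => h p.1 * (B S₀).indicator 1 p.2) (x 0, x (n + 1))
                ∂psmpLaw P solver := by
          refine setLIntegral_congr_fun (measurableSet_evaluatedEvent solver n S₀) fun x hx => ?_
          have hiff : x ∈ evaluatedEvent solver (n + 1) S ↔ x (n + 1) ∈ B S₀ := by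
            change evaluatedEdges solver (n + 1) (frestrictLe (n + 1) x) = S ↔
              S₀ ∪ traversedEdges G start τ (solver.policy (x (n + 1))) = S
            rw [evaluatedEdges_succ, show evaluatedEdges solver n (frestrictLe n x) = S₀ from hx]
          by_cases hb : x (n + 1) ∈ B S₀
          · simp [Set.indicator_of_mem hb, Set.indicator_of_mem (hiff.2 hb)]
          · simp [Set.indicator_of_notMem hb, Set.indicator_of_notMem (mt hiff.1 hb)]
        have hm1 : Measurable (fun p : World G × World G => h p.1 * (B S₀).indicator 1 p.2) :=
          (hh.comp measurable_fst).mul ((measurable_one.indicator (hB S₀)).comp measurable_snd)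
        rw [e1, setLIntegral_evaluatedEvent_succ P solver n S₀ hm1]
        have e2 : ∀ φ : World G, ∫⁻ ψ, (fun p : World G × World G =>
            h p.1 * (B S₀).indicator 1 p.2) (φ, ψ) ∂worldPosterior P S₀ (S₀.domRestrict φ) =
              worldPosterior P S₀ (S₀.domRestrict φ) (B S₀) * h φ := by
          intro φ
          simp only
          rw [lintegral_const_mul _ (measurable_one.indicator (hB S₀)),
            lintegral_indicator_one (hB S₀), mul_comm]
        simp only [e2]
        -- The induction hypothesis is used with `h` weighted by the transition probability, itself
        -- a function of the true world.
        rw [hl S₀ (fun φ => worldPosterior P S₀ (S₀.domRestrict φ) (B S₀) * h φ)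
          ((((worldPosterior P S₀).measurable_coe (hB S₀)).comp
            (measurable_edgeRestrict S₀)).mul hh)]
        refine lintegral_congr fun φ => ?_
        by_cases hS : S₀ ⊆ S
        · simp only [q, dif_pos hS, ← mul_assoc]
          rfl
        · have : B S₀ = ∅ := by
            ext ψ
            simp only [B, Set.mem_ofPred_eq, Set.mem_empty_iff_false, iff_false]
            exact fun hc => hS (hc ▸ Set.subset_union_left)
          simp [q, dif_neg hS, this]
      simp only [key, Finset.sum_mul]
      rw [lintegral_finsetSum]
      intro S₀ _
      refine Measurable.mul ?_ hh
      by_cases hS : S₀ ⊆ S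
      · simp only [q, dif_pos hS]
        exact hq S₀
      · simp only [q, dif_neg hS]
        exact measurable_const

/-- A sampled world has the law of the true world. -/
theorem psmpLaw_map_succ (n : ℕ) : (psmpLaw P solver).map (fun x => x (n + 1)) = P := by
  have := Fintype.ofFinite (Set G.edgeSet)
  refine Measure.ext_of_lintegral _ fun F hF => ?_
  rw [lintegral_map hF (by fun_prop), lintegral_eq_sum_evaluatedEvent P solver n]
  conv_rhs => rw [← psmpLaw_map_zero P solver]
  rw [lintegral_map hF (by fun_prop), lintegral_eq_sum_evaluatedEvent P solver n]
  refine Finset.sum_congr rfl fun S _ => ?_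
  obtain ⟨l, hlm, hl⟩ := exists_likelihood P solver n S
  have hk : Measurable (fun y => ∫⁻ ψ, F ψ ∂worldPosterior P S y) := hF.lintegral_kernel
  rw [setLIntegral_evaluatedEvent_succ P solver n S (F := fun p => F p.2) (hF.comp measurable_snd),
    hl F hF, hl (fun φ => ∫⁻ ψ, F ψ ∂worldPosterior P S (S.domRestrict φ))
      (hk.comp (measurable_edgeRestrict S)),
    -- The likelihood sees only the weights on `S`, which the posterior is conditioned on, so it is
    -- constant under the inner integral.
    ← lintegral_lintegral_worldPosterior P S (f := fun p => l p.1 * F p.2)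
      ((hlm.comp measurable_fst).mul (hF.comp measurable_snd))]
  refine lintegral_congr fun φ => ?_
  exact (lintegral_const_mul _ hF).symm

/-- A sampled world agrees with the true world on the edges evaluated before. -/
theorem ae_psmpLaw_eqOn (n : ℕ) :
    ∀ᵐ x ∂psmpLaw P solver,
      Set.EqOn (x (n + 1)) (x 0) (evaluatedEdges solver n (frestrictLe n x)) := by
  have hS : ∀ S : Set G.edgeSet, ∀ᵐ x ∂psmpLaw P solver,
      x ∈ evaluatedEvent solver n S → S.domRestrict (x (n + 1)) = S.domRestrict (x 0) := by
    intro S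
    let D : Set ((S → I) × World G) := {p | S.domRestrict p.2 = p.1}ᶜ
    have hD : MeasurableSet D := (measurableSet_eq_fun
      ((measurable_edgeRestrict S).comp measurable_snd) measurable_fst).compl
    have hr : Measurable (fun p : World G × World G => (S.domRestrict p.1, p.2)) :=
      ((measurable_edgeRestrict S).comp measurable_fst).prodMk measurable_snd
    have hF : Measurable (fun p : World G × World G =>
        D.indicator (1 : (S → I) × World G → ENNReal) (S.domRestrict p.1, p.2)) :=
      (measurable_one.indicator hD).comp hr
    have h0 : ∫⁻ x in evaluatedEvent solver n S,
        D.indicator (1 : (S → I) × World G → ENNReal) (S.domRestrict (x 0), x (n + 1))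
          ∂psmpLaw P solver = 0 := by
      rw [setLIntegral_evaluatedEvent_succ P solver n S hF]
      -- The event may be dropped: even over all trajectories, averaging over prior and posterior
      -- replaces the sample by the true world, which never disagrees with itself.
      refine le_antisymm ((setLIntegral_le_lintegral _ _).trans ?_) zero_le
      have hK : Measurable (fun φ : World G => ∫⁻ ψ, D.indicator (1 : (S → I) × World G → ENNReal)
          (S.domRestrict φ, ψ) ∂worldPosterior P S (S.domRestrict φ)) :=
        ((measurable_one.indicator hD).lintegral_kernel_prod_right'
          (κ := worldPosterior P S)).comp (measurable_edgeRestrict S)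
      have := lintegral_map (μ := psmpLaw P solver) hK (measurable_pi_apply 0)
      rw [← this, psmpLaw_map_zero, lintegral_lintegral_worldPosterior P S
        (measurable_one.indicator hD)]
      simp [D]
    have hx : Measurable (fun x : ℕ → World G => (x 0, x (n + 1))) := by fun_prop
    have h0 := (lintegral_eq_zero_iff (hF.comp hx)).1 h0
    have h1 := (ae_restrict_iff' (measurableSet_evaluatedEvent solver n S)).1 h0
    filter_upwards [h1] with x hx hxS
    by_contra hne
    have : D.indicator (1 : (S → I) × World G → ENNReal) (S.domRestrict (x 0), x (n + 1)) = 0 :=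
      hx hxS
    rw [Set.indicator_of_mem (show (S.domRestrict (x 0), x (n + 1)) ∈ D from hne)] at this
    exact one_ne_zero this
  filter_upwards [ae_all_iff.2 hS] with x hx e he
  exact congrFun (hx _ rfl) ⟨e, he⟩

end PosteriorSampling

/-! ### Regret decomposition and the pathwise count of new edges. -/

section Regret

open Preorder

variable {V : Type*} [DecidableEq V] {G : SimpleGraph V} {start goal : V} {τ : ℕ}

theorem stepReward_graphMDP_mem_Icc (φ : World G) (π : GraphPolicy G) (s : V) :
    (graphMDP G start goal τ φ).stepReward π s ∈ Set.Icc (-1 : ℝ) 0 := by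
  unfold DetMDP.stepReward
  cases π s with
  | none => simp
  | some a =>
    simp only [graphMDP]
    split_ifs
    · simp
    · have := (φ a.edge).2
      constructor <;> linarith [this.1, this.2]

theorem value_graphMDP_mem_Icc (φ : World G) (π : GraphPolicy G) :
    (graphMDP G start goal τ φ).value π ∈ Set.Icc (-τ : ℝ) 0 := by
  unfold DetMDP.value
  constructor
  · have := Finset.card_nsmul_le_sum (Finset.range τ) _ (-1 : ℝ) fun j _ =>
      (stepReward_graphMDP_mem_Icc (goal := goal) (start := start) (τ := τ) φ π
        ((graphMDP G start goal τ φ).state π j)).1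
    rwa [Finset.card_range, nsmul_eq_mul, mul_neg_one] at this
  · exact Finset.sum_nonpos fun j _ => (stepReward_graphMDP_mem_Icc φ π _).2

/-- The trajectory is governed by the dynamics alone, so the weights enter only through the rewards
of the traversed edges. -/
theorem value_graphMDP_congr {φ φ' : World G} {π : GraphPolicy G}
    (h : Set.EqOn φ φ' (traversedEdges G start τ π)) :
    (graphMDP G start goal τ φ).value π = (graphMDP G start goal τ φ').value π := by
  refine Finset.sum_congr rfl fun j hj => ?_
  have key : ∀ a, π ((graphDynamics G start τ).state π j) = some a → φ a.edge = φ' a.edge :=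
    fun a ha => h ⟨j, Finset.mem_range.1 hj, a, ha, rfl⟩
  change (graphMDP G start goal τ φ).stepReward π ((graphDynamics G start τ).state π j) =
    (graphMDP G start goal τ φ').stepReward π ((graphDynamics G start τ).state π j)
  unfold DetMDP.stepReward
  cases hπ : π ((graphDynamics G start τ).state π j) with
  | none => rfl
  | some a => simp only [graphMDP, key a hπ]

theorem measurable_value_graphMDP (π : GraphPolicy G) :
    Measurable fun φ : World G => (graphMDP G start goal τ φ).value π := by
  refine Finset.measurable_sum (Finset.range τ) fun j _ => ?_
  change Measurable fun φ : World G =>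
    (graphMDP G start goal τ φ).stepReward π ((graphDynamics G start τ).state π j)
  unfold DetMDP.stepReward
  cases π ((graphDynamics G start τ).state π j) with
  | none => exact measurable_const
  | some a =>
    simp only [graphMDP]
    split_ifs
    · exact measurable_const
    · exact (measurable_subtype_coe.comp (measurable_pi_apply _)).neg

/-- Each episode counted here strictly enlarges the evaluated set. -/
theorem sum_newEdges_le_ncard [Finite V] (solver : ShortestPathSolver G start goal τ)
    (x : ℕ → World G) (m : ℕ)
    [∀ k, Decidable (traversedEdges G start τ (solver.policy (x (k + 1))) ⊆
      evaluatedEdges solver k (frestrictLe k x))] :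
    (∑ k ∈ Finset.range m,
      if traversedEdges G start τ (solver.policy (x (k + 1))) ⊆
        evaluatedEdges solver k (frestrictLe k x) then 0 else 1) ≤
      (evaluatedEdges solver m (frestrictLe m x)).ncard := by
  induction m with
  | zero => simp
  | succ m ih =>
    rw [Finset.sum_range_succ, evaluatedEdges_succ]
    split_ifs with h
    · rwa [add_zero, Set.union_eq_self_of_subset_right h]
    · have : (evaluatedEdges solver m (frestrictLe m x)).ncard <
          (evaluatedEdges solver m (frestrictLe m x) ∪
            traversedEdges G start τ (solver.policy (x (m + 1)))).ncard :=
        Set.ncard_lt_ncard (Set.ssubset_iff_subset_ne.2 ⟨Set.subset_union_left,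
          fun h' => h (h' ▸ Set.subset_union_right)⟩) (Set.toFinite _)
      omega

/-- The worlds that PSMP samples overestimate the values of the executed policies by at most `τ` in
an episode that evaluates a new edge, and not at all in the others. -/
theorem sum_value_sub_value_le [Finite V] (solver : ShortestPathSolver G start goal τ)
    (x : ℕ → World G) (m : ℕ)
    (hx : ∀ k, Set.EqOn (x (k + 1)) (x 0) (evaluatedEdges solver k (frestrictLe k x))) :
    ∑ k ∈ Finset.range m, ((graphMDP G start goal τ (x (k + 1))).value (solver.policy (x (k + 1))) -
      (graphMDP G start goal τ (x 0)).value (solver.policy (x (k + 1)))) ≤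
      τ * (min (Nat.card G.edgeSet) m : ℕ) := by
  classical
  let N : ℕ → ℕ := fun k => if traversedEdges G start τ (solver.policy (x (k + 1))) ⊆
    evaluatedEdges solver k (frestrictLe k x) then 0 else 1
  have h1 : ∑ k ∈ Finset.range m, N k ≤ min (Nat.card G.edgeSet) m := by
    refine le_min ((sum_newEdges_le_ncard solver x m).trans ?_) ?_
    · rw [← Set.ncard_univ]
      exact Set.ncard_le_ncard (Set.subset_univ _) (Set.toFinite _)
    · have := Finset.sum_le_card_nsmul (Finset.range m) N 1 fun k _ => by
        simp only [N]; split_ifs <;> simp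
      simpa using this
  calc _ ≤ ∑ k ∈ Finset.range m, (τ : ℝ) * (N k : ℕ) := by
        refine Finset.sum_le_sum fun k _ => ?_
        by_cases hk : traversedEdges G start τ (solver.policy (x (k + 1))) ⊆
            evaluatedEdges solver k (frestrictLe k x)
        · simp only [N, if_pos hk]
          rw [value_graphMDP_congr ((hx k).mono hk)]
          simp
        · simp only [N, if_neg hk]
          have h2 := (value_graphMDP_mem_Icc (start := start) (goal := goal) (τ := τ) (x (k + 1))
            (solver.policy (x (k + 1)))).2
          have h3 := (value_graphMDP_mem_Icc (start := start) (goal := goal) (τ := τ) (x 0)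
            (solver.policy (x (k + 1)))).1
          push_cast
          linarith
    _ = τ * ((∑ k ∈ Finset.range m, N k : ℕ) : ℝ) := by
        rw [Nat.cast_sum, Finset.mul_sum]
    _ ≤ _ := by gcongr

/-- There are finitely many policies, so the map is a finite sum over the measurable pieces where
the solver's output is fixed. -/
theorem measurable_value_policy [Finite V] (solver : ShortestPathSolver G start goal τ) :
    Measurable fun p : World G × World G =>
      (graphMDP G start goal τ p.1).value (solver.policy p.2) := by
  classical
  have := Fintype.ofFinite (GraphPolicy G)
  have h : (fun p : World G × World G =>
      (graphMDP G start goal τ p.1).value (solver.policy p.2)) = fun p =>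
      ∑ π : GraphPolicy G, {φ | solver.policy φ = π}.indicator 1 p.2 *
        (graphMDP G start goal τ p.1).value π := by
    ext p
    rw [Finset.sum_eq_single (solver.policy p.2)]
    · simp
    · intro π _ hπ
      simp [hπ.symm]
    · simp
  rw [h]
  exact Finset.measurable_sum _ fun π _ =>
    ((measurable_one.indicator (solver.measurable π)).comp measurable_snd).mul
      ((measurable_value_graphMDP π).comp measurable_fst)

theorem measurable_value_policy_apply [Finite V] (solver : ShortestPathSolver G start goal τ)
    (i j : ℕ) : Measurable fun x : ℕ → World G =>
      (graphMDP G start goal τ (x i)).value (solver.policy (x j)) := by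
  have h : Measurable fun x : ℕ → World G => (x i, x j) := by fun_prop
  exact (measurable_value_policy solver).comp h

variable (solver : ShortestPathSolver G start goal τ)

theorem value_policy_le_bestDiscoveredValue (x : ℕ → World G) (k : ℕ) :
    (graphMDP G start goal τ (x 0)).value (solver.policy (x (k + 1))) ≤
      bestDiscoveredValue solver x k :=
  Finset.le_sup' (fun j => (graphMDP G start goal τ (x 0)).value (solver.policy (x (j + 1))))
    (Finset.self_mem_range_succ k)

theorem bestDiscoveredValue_mem_Icc (x : ℕ → World G) (k : ℕ) :
    bestDiscoveredValue solver x k ∈ Set.Icc (-τ : ℝ) 0 :=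
  ⟨(value_graphMDP_mem_Icc _ _).1.trans (value_policy_le_bestDiscoveredValue solver x k),
    Finset.sup'_le _ _ fun _ _ => (value_graphMDP_mem_Icc _ _).2⟩

variable [Finite V]

theorem measurable_bestDiscoveredValue (k : ℕ) :
    Measurable fun x => bestDiscoveredValue solver x k := by
  exact Finset.measurable_range_sup'' fun j _ => measurable_value_policy_apply solver 0 (j + 1)

variable (P : Measure (World G)) [IsProbabilityMeasure P]

theorem integrable_value_policy (i j : ℕ) :
    Integrable (fun x => (graphMDP G start goal τ (x i)).value (solver.policy (x j)))
      (psmpLaw P solver) := by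
  refine Integrable.of_bound (measurable_value_policy_apply solver i j).aestronglyMeasurable τ
    (.of_forall fun x => ?_)
  have := value_graphMDP_mem_Icc (start := start) (goal := goal) (τ := τ) (x i)
    (solver.policy (x j))
  rw [Real.norm_eq_abs, abs_le]
  constructor <;> linarith [this.1, this.2, (Nat.cast_nonneg τ : (0 : ℝ) ≤ τ)]

theorem integrable_regret (m : ℕ) : Integrable (regret solver m) (psmpLaw P solver) := by
  refine integrable_finsetSum _ fun k _ => (integrable_value_policy solver P 0 0).sub ?_
  refine Integrable.of_bound (measurable_bestDiscoveredValue solver k).aestronglyMeasurable τ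
    (.of_forall fun x => ?_)
  have := bestDiscoveredValue_mem_Icc solver x k
  rw [Real.norm_eq_abs, abs_le]
  constructor <;> linarith [this.1, this.2, (Nat.cast_nonneg τ : (0 : ℝ) ≤ τ)]

/-- The optimal value of a sampled world has the same mean as that of the true world. -/
theorem integral_value_policy_succ (k : ℕ) :
    ∫ x, (graphMDP G start goal τ (x (k + 1))).value (solver.policy (x (k + 1)))
        ∂psmpLaw P solver =
      ∫ x, (graphMDP G start goal τ (x 0)).value (solver.policy (x 0)) ∂psmpLaw P solver := by
  have hm : Measurable fun φ : World G => (graphMDP G start goal τ φ).value (solver.policy φ) :=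
    (measurable_value_policy solver).comp (measurable_id.prodMk measurable_id)
  have h : ∀ i : ℕ, (psmpLaw P solver).map (fun x => x i) = P →
      ∫ x, (graphMDP G start goal τ (x i)).value (solver.policy (x i)) ∂psmpLaw P solver =
        ∫ φ, (graphMDP G start goal τ φ).value (solver.policy φ) ∂P := by
    intro i hi
    conv_rhs => rw [← hi]
    have hx : Measurable fun x : ℕ → World G => x i := by fun_prop
    rw [integral_map hx.aemeasurable hm.aestronglyMeasurable]
  rw [h _ (psmpLaw_map_succ P solver k), h 0 (psmpLaw_map_zero P solver)]

/-- The Bayesian regret of PSMP is at most `τ` times the number of edges, and at most `τ` times the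
number of episodes. -/
theorem integral_regret_le (m : ℕ) :
    ∫ x, regret solver m x ∂psmpLaw P solver ≤ τ * (min (Nat.card G.edgeSet) m : ℕ) := by
  let W : ℕ → (ℕ → World G) → ℝ := fun i x =>
    (graphMDP G start goal τ (x i)).value (solver.policy (x i))
  have hW : ∀ i, Integrable (W i) (psmpLaw P solver) := fun i =>
    integrable_value_policy solver P i i
  have hsum : Integrable (fun x => ∑ k ∈ Finset.range m, (W 0 x - W (k + 1) x))
      (psmpLaw P solver) := integrable_finsetSum _ fun k _ => (hW 0).sub (hW (k + 1))
  have hae : ∀ᵐ x ∂psmpLaw P solver, regret solver m x ≤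
      ∑ k ∈ Finset.range m, (W 0 x - W (k + 1) x) +
        τ * (min (Nat.card G.edgeSet) m : ℕ) := by
    filter_upwards [ae_all_iff.2 (ae_psmpLaw_eqOn P solver)] with x hx
    refine le_trans ?_ (add_le_add_right (sum_value_sub_value_le solver x m hx) _)
    rw [← Finset.sum_add_distrib]
    refine Finset.sum_le_sum fun k _ => ?_
    have := value_policy_le_bestDiscoveredValue solver x k
    simp only [W]
    linarith
  refine (integral_mono_ae (integrable_regret solver P m) (hsum.add (integrable_const _))
    hae).trans_eq ?_
  rw [integral_add' hsum (integrable_const _), integral_finsetSum _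
    (f := fun k x => W 0 x - W (k + 1) x) fun k _ => (hW 0).sub (hW (k + 1))]
  have : ∀ k, ∫ x, (W 0 x - W (k + 1) x) ∂psmpLaw P solver = 0 := fun k => by
    rw [integral_sub (hW 0) (hW (k + 1)), sub_eq_zero]
    exact (integral_value_policy_succ solver P k).symm
  simp [this]

end Regret

/-! ### From the number of edges to the square-root bound. -/

section Counting

variable {V : Type*} [Fintype V] (G : SimpleGraph V)

theorem card_edgeSet_le_card_mul_numActions :
    Nat.card G.edgeSet ≤ Fintype.card V * numActions (GraphAction G) := by
  have hs : Function.Surjective (fun p : Σ s, GraphAction G s => p.2.edge) := by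
    rintro ⟨e, he⟩
    induction e with
    | h u v => exact ⟨⟨u, s(u, v), he, Sym2.mem_mk_left u v⟩, rfl⟩
  calc Nat.card G.edgeSet ≤ Nat.card (Σ s, GraphAction G s) := Nat.card_le_card_of_surjective _ hs
    _ = ∑ s, Nat.card (GraphAction G s) := Nat.card_sigma
    _ ≤ ∑ _s : V, numActions (GraphAction G) := Finset.sum_le_sum fun s _ =>
        le_ciSup (f := fun s => Nat.card (GraphAction G s)) (Set.finite_range _).bddAbove s
    _ = _ := by simp

/-- This keeps the logarithm in the final bound away from zero: an edge has two distinct endpoints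
and is an action at each. -/
theorem two_le_card_mul_numActions (hE : 0 < Nat.card G.edgeSet) :
    2 ≤ Fintype.card V * numActions (GraphAction G) := by
  have h := hE.trans_le (card_edgeSet_le_card_mul_numActions G)
  have hA : 0 < numActions (GraphAction G) := Nat.pos_of_mul_pos_left h
  have hV : 1 < Fintype.card V := by
    obtain ⟨⟨e, he⟩⟩ := (Nat.card_pos_iff.1 hE).1
    induction e with
    | h u v => exact Fintype.one_lt_card_iff.2 ⟨u, v, G.ne_of_adj he⟩
  nlinarith

theorem min_card_edgeSet_le (m T : ℕ) (hm : m ≤ T) :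
    ((min (Nat.card G.edgeSet) m : ℕ) : ℝ) ≤
      2 * √((Fintype.card V * numActions (GraphAction G) * T : ℕ) *
        Real.log (Fintype.card V * numActions (GraphAction G) * T : ℕ)) := by
  set N := Fintype.card V * numActions (GraphAction G) * T
  set r := min (Nat.card G.edgeSet) m
  rcases Nat.eq_zero_or_pos r with h0 | h0
  -- Degenerate case: the argument of the logarithm may be `0` here, but a square root is
  -- nonnegative anyway.
  · rw [h0, Nat.cast_zero]; positivity
  have hE : 0 < Nat.card G.edgeSet := h0.trans_le (min_le_left _ _)
  have hT : 1 ≤ T := (h0.trans_le (min_le_right _ _)).trans_le hm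
  have hN2 : 2 ≤ N := (two_le_card_mul_numActions G hE).trans (Nat.le_mul_of_pos_right _ hT)
  have hrN : r * r ≤ N := Nat.mul_le_mul
    ((min_le_left _ _).trans (card_edgeSet_le_card_mul_numActions G)) ((min_le_right _ _).trans hm)
  have hN2' : (2 : ℝ) ≤ N := by exact_mod_cast hN2
  have hrN' : (r : ℝ) * r ≤ N := by exact_mod_cast hrN
  -- The value `1/4` is what `(r / 2) ^ 2 ≤ N / 4 ≤ N * log N` requires; it follows from `log 2 >
  -- 1/4`.
  have hlog : (1 / 4 : ℝ) ≤ Real.log N := by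
    linarith [Real.log_two_gt_d9, Real.log_le_log (by norm_num) hN2']
  have : (r : ℝ) / 2 ≤ √(N * Real.log N) := Real.le_sqrt_of_sq_le (by nlinarith)
  linarith

end Counting

theorem theorem2 :
    ∃ C : ℝ, 0 < C ∧
      ∀ (V : Type*) [Fintype V] [DecidableEq V] (G : SimpleGraph V) (start goal : V)
        (τ : ℕ) (_ : 0 < τ) (P : Measure (World G)) [IsProbabilityMeasure P]
        (solver : ShortestPathSolver G start goal τ) (T : ℕ),
        Integrable (regret solver (T ⌈/⌉ τ)) (psmpLaw P solver) ∧
        ∫ x, regret solver (T ⌈/⌉ τ) x ∂(psmpLaw P solver) ≤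
          C * (τ * √((Fintype.card V * numActions (GraphAction G) * T : ℕ) *
            Real.log (Fintype.card V * numActions (GraphAction G) * T : ℕ))) := by
  -- The constant is the factor `2` of `min_card_edgeSet_le`.
  refine ⟨2, two_pos, fun V _ _ G start goal τ hτ P _ solver T =>
    ⟨integrable_regret solver P _, ?_⟩⟩
  refine (integral_regret_le solver P _).trans ?_
  have hm : T ⌈/⌉ τ ≤ T := (ceilDiv_le_iff_le_mul hτ).2 (Nat.le_mul_of_pos_left _ hτ)
  rw [mul_left_comm]
  exact mul_le_mul_of_nonneg_left (min_card_edgeSet_le G _ T hm) (Nat.cast_nonneg τ)
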